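/- Let $\Omega\subset\mathbb R^3$ be a bounded, simply connected domain with smooth boundary $\partial\Omega$ and outer unit normal $n$, and let $\overline\alpha\ge\underline\alpha>0$. Let $\Xi$ (smooth in $\Omega$) and $\sigma_s$ (measurable) be functions on $\Omega$ with $\underline\alpha\le\Xi,\sigma_s\le\overline\alpha$. For $g\in(-1,1)$ put $$\kappa=\frac{3}{7(1+g+g^2)},\qquad \kappa'=\frac{3}{1+g}\,\kappa,\qquad D=\frac{1}{3(1-g)\sigma_s}.$$ For $\sigma_a\in C^1(\overline\Omega)$ with $\underline\alpha\le\sigma_a\le\overline\alpha$ in $\Omega$ and a source $f\in L^2(\partial\Omega)$, consider the simplified $P_2$ system $$\begin{aligned} -\nabla\cdot D\nabla\phi_1+\sigma_a\phi_1-\tfrac23\sigma_a\phi_2&=0&&\text{in }\Omega,\\ -\nabla\cdot D\nabla\phi_2+\Big(\tfrac{5}{9\kappa'}\tfrac1D+\tfrac{4}{9\kappa}\sigma_a\Big)\phi_2-\tfrac{2}{3\kappa}\sigma_a\phi_1&=0&&\text{in }\Omega,\\ n\cdot D\nabla\phi_1+\tfrac12\phi_1-\tfrac18\phi_2&=\tfrac12f&&\text{on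 }\partial\Omega,\\ n\cdot D\nabla\phi_2+\tfrac{7}{24\kappa}\phi_2-\tfrac{1}{8\kappa}\phi_1&=-\tfrac{1}{8\kappa}f&&\text{on }\partial\Omega, \end{aligned}$$ understood in the weak sense with $\phi_1,\phi_2\in H^1(\Omega)$, and the internal datum $H=\Xi\,\sigma_a\,(\phi_1-\tfrac23\phi_2)$. **Theorem 4.1.** There is a constant $\mathfrak c$, depending only on $\Omega$, $\Xi$, $\sigma_s$, $\underline\alpha$ and $\overline\alpha$, such that the following holds. Let $g\in(-1,1)$, let $\sigma_a,\widetilde\sigma_a\in C^1(\overline\Omega)$ take values in $[\underline\alpha,\overline\alpha]$ on $\Omega$, let $f_j\in L^2(\partial\Omega)$, and let $(\phi_{1,j},\phi_{2,j})$ and $(\widetilde\phi_{1,j},\widetilde\phi_{2,j})$ be solutions of the system with source $f_j$ and absorption coefficients $\sigma_a$ and $\widetilde\sigma_a$ respectively (with the same $\Xi$, $\sigma_s$, $g$), with data $H_j$ and $\widetilde H_j$. Assume that $\phi_{1,j}-\tfrac23\phi_{2,j}\ne0$ a.e. in $\Omega$. Then $H_j=\widetilde H_j$ a.e. in $\Omega$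 implies $\sigma_a=\widetilde\sigma_a$ a.e. in $\Omega$. Moreover, $$\big\|(\sigma_a-\widetilde\sigma_a)(\phi_{1,j}-\tfrac23\phi_{2,j})\big\|_{L^2(\Omega)}\le\mathfrak c\,\|H_j-\widetilde H_j\|_{L^2(\Omega)}.$$ -/

import Mathlib

open MeasureTheory Filter Topology
open scoped ContDiff NNReal ENNReal MeasureTheory

namespace SP2

/-- Three-dimensional Euclidean space. -/
abbrev E3 : Type := EuclideanSpace ℝ (Fin 3)

/-- The boundary of `Ω` is smooth: near each of its points `Ω` is the sublevel set `ρ < 0` of a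
smooth function `ρ` whose gradient does not vanish at that point. -/
def HasSmoothBoundary (Ω : Set E3) : Prop :=
  ∀ p ∈ frontier Ω, ∃ (U : Set E3) (ρ : E3 → ℝ), IsOpen U ∧ p ∈ U ∧ ContDiffOn ℝ ∞ ρ U ∧
    gradient ρ p ≠ 0 ∧ Ω ∩ U = {x ∈ U | ρ x < 0}

/-- Bounded simply connected domains with smooth boundary. -/
structure IsSmoothDomain (Ω : Set E3) : Prop where
  isOpen : IsOpen Ω
  isBounded : Bornology.IsBounded Ω
  simplyConnected : SimplyConnectedSpace Ω
  smoothBoundary : HasSmoothBoundary Ω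

/-- Lebesgue measure on `Ω`. -/
noncomputable def vol (Ω : Set E3) : Measure E3 := (volume : Measure E3).restrict Ω

/-- Surface measure on `∂Ω`: the two-dimensional Hausdorff measure, normalized so that it is area
on planes. -/
noncomputable def surf (Ω : Set E3) : Measure E3 :=
  (Measure.euclideanHausdorffMeasure 2 : Measure E3).restrict (frontier Ω)

/-- `G` is the weak gradient of `u` in `Ω`. -/
def IsWeakGradient (Ω : Set E3) (u : E3 → ℝ) (G : E3 → E3) : Prop :=
  ∀ ψ : E3 → ℝ, ContDiff ℝ ∞ ψ → HasCompactSupport ψ → tsupport ψ ⊆ Ω →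
    (∫ x, ψ x • G x ∂(vol Ω)) = -(∫ x, u x • gradient ψ x ∂(vol Ω))

/-- `u` lies in the Sobolev space `H¹(Ω)` and `G` is its weak gradient. -/
structure MemH1 (Ω : Set E3) (u : E3 → ℝ) (G : E3 → E3) : Prop where
  memLp : MemLp u 2 (vol Ω)
  memLp_grad : MemLp G 2 (vol Ω)
  isWeakGradient : IsWeakGradient Ω u G

/-- `τ ∈ L²(∂Ω)` is the trace on `∂Ω` of the function `u ∈ H¹(Ω)` with weak gradient `G`: it is the
limit in `L²(∂Ω)` of the boundary values of functions, smooth up to the boundary, that converge to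
`u` in `H¹(Ω)`. -/
def IsTrace (Ω : Set E3) (u : E3 → ℝ) (G : E3 → E3) (τ : E3 → ℝ) : Prop :=
  MemLp τ 2 (surf Ω) ∧ ∃ v : ℕ → E3 → ℝ, (∀ k, ContDiff ℝ ∞ (v k)) ∧
    Tendsto (fun k => eLpNorm (fun x => v k x - u x) 2 (vol Ω)) atTop (𝓝 0) ∧
    Tendsto (fun k => eLpNorm (fun x => gradient (v k) x - G x) 2 (vol Ω)) atTop (𝓝 0) ∧
    Tendsto (fun k => eLpNorm (fun x => v k x - τ x) 2 (surf Ω)) atTop (𝓝 0)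

/-- `κ = 3 / (7 (1 + g + g²))`. -/
noncomputable def kappa (g : ℝ) : ℝ := 3 / (7 * (1 + g + g ^ 2))

/-- `κ' = 3 κ / (1 + g)`. -/
noncomputable def kappa' (g : ℝ) : ℝ := 3 / (1 + g) * kappa g

/-- The diffusion coefficient `D = 1 / (3 (1 - g) σₛ)`. -/
noncomputable def diffCoeff (g : ℝ) (σs : E3 → ℝ) (x : E3) : ℝ := 1 / (3 * (1 - g) * σs x)

/-- `(φ₁, φ₂) ∈ H¹(Ω)²` is a weak solution of the simplified `P₂` system

* `-∇·D∇φ₁ + σₐ φ₁ - (2/3) σₐ φ₂ = 0` in `Ω`,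
* `-∇·D∇φ₂ + (5/(9κ'D) + (4/(9κ)) σₐ) φ₂ - (2/(3κ)) σₐ φ₁ = 0` in `Ω`,
* `n·D∇φ₁ + (1/2) φ₁ - (1/8) φ₂ = (1/2) f` on `∂Ω`,
* `n·D∇φ₂ + (7/(24κ)) φ₂ - (1/(8κ)) φ₁ = -(1/(8κ)) f` on `∂Ω`;

the boundary conditions enter through integration by parts against functions that are smooth up
to the boundary, and `τ₁`, `τ₂` are the traces of `φ₁`, `φ₂`. -/
def IsSolution (Ω : Set E3) (g : ℝ) (σa σs f φ₁ φ₂ : E3 → ℝ) : Prop :=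
  ∃ (G₁ G₂ : E3 → E3) (τ₁ τ₂ : E3 → ℝ),
    MemH1 Ω φ₁ G₁ ∧ MemH1 Ω φ₂ G₂ ∧ IsTrace Ω φ₁ G₁ τ₁ ∧ IsTrace Ω φ₂ G₂ τ₂ ∧
    (∀ v : E3 → ℝ, ContDiff ℝ ∞ v →
      (∫ x, diffCoeff g σs x * inner ℝ (G₁ x) (gradient v x) ∂(vol Ω))
        + (∫ x, (σa x * φ₁ x - 2 / 3 * σa x * φ₂ x) * v x ∂(vol Ω))
        + (∫ x, (1 / 2 * τ₁ x - 1 / 8 * τ₂ x) * v x ∂(surf Ω))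
      = (∫ x, 1 / 2 * f x * v x ∂(surf Ω))) ∧
    (∀ v : E3 → ℝ, ContDiff ℝ ∞ v →
      (∫ x, diffCoeff g σs x * inner ℝ (G₂ x) (gradient v x) ∂(vol Ω))
        + (∫ x, ((5 / (9 * kappa' g) * (1 / diffCoeff g σs x) + 4 / (9 * kappa g) * σa x) * φ₂ x
            - 2 / (3 * kappa g) * σa x * φ₁ x) * v x ∂(vol Ω))
        + (∫ x, (7 / (24 * kappa g) * τ₂ x - 1 / (8 * kappa g) * τ₁ x) * v x ∂(surf Ω))
      = (∫ x, -(1 / (8 * kappa g)) * f x * v x ∂(surf Ω)))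

/-- The internal datum (initial pressure field) `H = Ξ σₐ (φ₁ - (2/3) φ₂)`. -/
noncomputable def datum (Ξ σa φ₁ φ₂ : E3 → ℝ) (x : E3) : ℝ :=
  Ξ x * σa x * (φ₁ x - 2 / 3 * φ₂ x)

end SP2

/-! Write `ψ = φ₁ - (2/3) φ₂`. Because `4/(9κ) = (2/3) · 2/(3κ)`, the absorption coefficient enters
both equations only through the product `σₐ ψ`: it is the whole zero-order term of the first
equation, and the second contains `P φ₂ - 2/(3κ) σₐ ψ` with `P = 5/(9κ'D) ≥ 0`. Put `h = σₐ ψ - σₐ'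
ψ'`. Then `H - H' = Ξ h`, and the differences `w₁`, `w₂` of the fields solve a linear system with
source `h` whose coefficients do not involve the absorption at all.

Testing the first equation with `w₁`, the second with `κ w₂`, and adding gives a coercive energy
identity. Its boundary form `(1/2) τ₁² - (1/4) τ₁ τ₂ + (7/24) τ₂²` is positive definite, the
coupling becomes `h w₁ - (2/3) h w₂`, and the energy controls gradients and traces. The term with
`P` cannot supply the `L²` bound uniformly in `g`, since `P` degenerates as `g → ±1`; it is only
nonnegative. The `L²` norms come instead from Friedrichs' inequality (`friedrichs_smooth`,
`SmoothApprox.friedrichs`). Together with `D ≥ 1/(6β)` and `κ ≥ 1/7` this bounds `w₁`, `w₂` by `h`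
uniformly in `g` (`energy_estimate`, `solution_sub_estimate`).

Finally `(σₐ - σₐ') ψ = h - σₐ' (w₁ - (2/3) w₂)`, which gives the stability estimate
(`coefficient_estimate`). Uniqueness follows by dividing by `ψ ≠ 0`. -/

namespace SP2

/-! ### Exit of lines from a bounded open set -/

section ExitTime

variable {E : Type*} [NormedAddCommGroup E] [NormedSpace ℝ E]

/-- The first time at which the ray from `x` in direction `-e` leaves `Ω`. -/
noncomputable def exitTime (Ω : Set E) (e x : E) : ℝ := sInf {s : ℝ | 0 ≤ s ∧ x - s • e ∉ Ω}

/-- The point at which the ray from `x` in direction `-e` leaves `Ω`. -/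
noncomputable def exitPoint (Ω : Set E) (e x : E) : E := x - exitTime Ω e x • e

lemma bddBelow_exitTimes (Ω : Set E) (e x : E) : BddBelow {s : ℝ | 0 ≤ s ∧ x - s • e ∉ Ω} :=
  ⟨0, fun _ hs => hs.1⟩

lemma exitTime_nonneg (Ω : Set E) (e x : E) : 0 ≤ exitTime Ω e x :=
  Real.sInf_nonneg fun _ hs => hs.1

lemma mem_of_lt_exitTime {Ω : Set E} {e x : E} {s : ℝ} (hs : 0 ≤ s) (h : s < exitTime Ω e x) :
    x - s • e ∈ Ω := by
  by_contra hn
  exact absurd (csInf_le (bddBelow_exitTimes Ω e x) ⟨hs, hn⟩) (not_le.mpr h)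

lemma mem_exitTimes_of_norm_le {Ω : Set E} {e x : E} {R r s : ℝ} (he : ‖e‖ = 1)
    (hΩ : Ω ⊆ Metric.ball 0 R) (hx : ‖x‖ ≤ r) (hs : 0 ≤ s) (hrs : r + R ≤ s) :
    s ∈ {s : ℝ | 0 ≤ s ∧ x - s • e ∉ Ω} := by
  refine ⟨hs, fun hmem => ?_⟩
  have h1 : ‖x - s • e‖ < R := by simpa using hΩ hmem
  have h2 : ‖s • e‖ - ‖x‖ ≤ ‖x - s • e‖ := by
    rw [norm_sub_rev]; exact norm_sub_norm_le _ _
  rw [norm_smul, he, Real.norm_of_nonneg hs] at h2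
  linarith

lemma exitTimes_nonempty {Ω : Set E} {e : E} {R : ℝ} (he : ‖e‖ = 1)
    (hΩ : Ω ⊆ Metric.ball 0 R) (x : E) : {s : ℝ | 0 ≤ s ∧ x - s • e ∉ Ω}.Nonempty :=
  ⟨max 0 (‖x‖ + R), mem_exitTimes_of_norm_le he hΩ le_rfl (le_max_left _ _) (le_max_right _ _)⟩

lemma isClosed_exitTimes {Ω : Set E} (ho : IsOpen Ω) (e x : E) :
    IsClosed {s : ℝ | 0 ≤ s ∧ x - s • e ∉ Ω} := by
  have hc : Continuous fun s : ℝ => x - s • e := by fun_prop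
  exact isClosed_Ici.inter (ho.isClosed_compl.preimage hc)

lemma exitPoint_notMem {Ω : Set E} {e : E} {R : ℝ} (ho : IsOpen Ω) (he : ‖e‖ = 1)
    (hΩ : Ω ⊆ Metric.ball 0 R) (x : E) : exitPoint Ω e x ∉ Ω :=
  ((isClosed_exitTimes ho e x).csInf_mem (exitTimes_nonempty he hΩ x)
    (bddBelow_exitTimes Ω e x)).2

lemma exitTime_le {Ω : Set E} {e x : E} {R : ℝ} (he : ‖e‖ = 1) (hΩ : Ω ⊆ Metric.ball 0 R)
    (hx : x ∈ Ω) : exitTime Ω e x ≤ 2 * R := by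
  have h1 : ‖x‖ < R := by simpa using hΩ hx
  exact csInf_le (bddBelow_exitTimes Ω e x)
    (mem_exitTimes_of_norm_le he hΩ h1.le (by linarith [norm_nonneg x]) (by linarith))

lemma exitPoint_mem_frontier {Ω : Set E} {e x : E} {R : ℝ} (ho : IsOpen Ω) (he : ‖e‖ = 1)
    (hΩ : Ω ⊆ Metric.ball 0 R) (hx : x ∈ Ω) : exitPoint Ω e x ∈ frontier Ω := by
  have hn := exitPoint_notMem ho he hΩ x
  rw [ho.frontier_eq]
  refine ⟨?_, hn⟩
  have hpos : 0 < exitTime Ω e x := by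
    refine (exitTime_nonneg Ω e x).lt_of_ne fun h => hn ?_
    rwa [exitPoint, ← h, zero_smul, sub_zero]
  have hc : ContinuousOn (fun s : ℝ => x - s • e) (closure (Set.Ico 0 (exitTime Ω e x))) := by
    fun_prop
  have hmem := hc.image_closure (Set.mem_image_of_mem _
    (show exitTime Ω e x ∈ closure (Set.Ico 0 (exitTime Ω e x)) by
      rw [closure_Ico hpos.ne]; exact Set.right_mem_Icc.2 hpos.le))
  refine closure_mono ?_ hmem
  rintro _ ⟨s, hs, rfl⟩
  exact mem_of_lt_exitTime hs.1 hs.2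

open scoped Pointwise in
-- A point exits by time `s` exactly when it is a point of the complement moved along `e` by some `r
-- ∈ [0, s]`. The sublevel sets are therefore closed, as sums of a closed and a compact set.
lemma measurable_exitTime [MeasurableSpace E] [BorelSpace E] {Ω : Set E} {e : E} {R : ℝ}
    (ho : IsOpen Ω) (he : ‖e‖ = 1) (hΩ : Ω ⊆ Metric.ball 0 R) : Measurable (exitTime Ω e) := by
  refine measurable_of_Iic fun s => ?_
  have hset : exitTime Ω e ⁻¹' Set.Iic s = Ωᶜ + (fun r : ℝ => r • e) '' Set.Icc 0 s := by
    ext x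
    constructor
    · intro hx
      exact ⟨_, exitPoint_notMem ho he hΩ x, _, ⟨_, ⟨exitTime_nonneg Ω e x, hx⟩, rfl⟩,
        sub_add_cancel _ _⟩
    · rintro ⟨y, hy, _, ⟨r, hr, rfl⟩, rfl⟩
      exact (csInf_le (bddBelow_exitTimes Ω e _) ⟨hr.1, by simpa using hy⟩).trans hr.2
  rw [hset]
  exact (ho.isClosed_compl.add_right_of_isCompact
    (isCompact_Icc.image (by fun_prop))).measurableSet

/-- The fundamental theorem of calculus on the segment from `x` back to its exit point. The time
interval is enlarged to `[0, 2R]`, independent of `x`, with an indicator of `Ω`, so that the order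
of integration can later be exchanged. -/
lemma ofReal_le_exitPoint_add_lintegral {Ω : Set E} {e x : E} {R : ℝ} (he : ‖e‖ = 1)
    (hΩ : Ω ⊆ Metric.ball 0 R) (hx : x ∈ Ω) {F q : E → ℝ} (hF : ContDiff ℝ 1 F)
    (hq : Continuous q) (hFq : ∀ y, |fderiv ℝ F y e| ≤ q y) :
    ENNReal.ofReal (F x) ≤ ENNReal.ofReal (F (exitPoint Ω e x)) +
      ∫⁻ s in Set.Icc 0 (2 * R), Ω.indicator (fun y => ENNReal.ofReal (q y)) (x - s • e) := by
  set t := exitTime Ω e x with ht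
  have ht0 : 0 ≤ t := exitTime_nonneg Ω e x
  have htR : t ≤ 2 * R := exitTime_le he hΩ hx
  have hline : ∀ s : ℝ, HasDerivAt (fun s : ℝ => F (x - s • e)) (fderiv ℝ F (x - s • e) (-e)) s := by
    intro s
    have h1 : HasDerivAt (fun s : ℝ => x - s • e) (-e) s := by
      simpa using ((hasDerivAt_id s).smul_const e).const_sub x
    exact (hF.differentiable one_ne_zero _).hasFDerivAt.comp_hasDerivAt s h1
  have hcd : Continuous fun s : ℝ => fderiv ℝ F (x - s • e) (-e) :=
    ((hF.continuous_fderiv one_ne_zero).comp (by fun_prop)).clm_apply continuous_const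
  have hcq : Continuous fun s : ℝ => q (x - s • e) := by fun_prop
  have hftc := intervalIntegral.integral_eq_sub_of_hasDerivAt (fun s _ => hline s)
    (hcd.intervalIntegrable 0 t)
  have hle : F x ≤ F (exitPoint Ω e x) + ∫ s in (0 : ℝ)..t, q (x - s • e) := by
    have h2 : -∫ s in (0 : ℝ)..t, fderiv ℝ F (x - s • e) (-e) ≤
        ∫ s in (0 : ℝ)..t, q (x - s • e) := by
      rw [← intervalIntegral.integral_neg]
      refine intervalIntegral.integral_mono_on ht0 (hcd.neg.intervalIntegrable 0 t)
        (hcq.intervalIntegrable 0 t) fun s _ => ?_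
      rw [map_neg, neg_neg]
      exact (le_abs_self _).trans (hFq _)
    rw [hftc] at h2
    simp only [zero_smul, sub_zero] at h2
    rw [exitPoint, ← ht]
    linarith
  refine (ENNReal.ofReal_le_ofReal hle).trans (ENNReal.ofReal_add_le.trans ?_)
  gcongr
  -- The endpoint `t` is dropped because the exit point itself is not in `Ω`.
  rw [intervalIntegral.integral_of_le ht0, integral_Ioc_eq_integral_Ioo,
    ofReal_integral_eq_lintegral_ofReal]
  · calc ∫⁻ s in Set.Ioo 0 t, ENNReal.ofReal (q (x - s • e))
        = ∫⁻ s in Set.Ioo 0 t, Ω.indicator (fun y => ENNReal.ofReal (q y)) (x - s • e) := by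
          refine setLIntegral_congr_fun measurableSet_Ioo fun s hs => ?_
          have hmem : x - s • e ∈ Ω := mem_of_lt_exitTime hs.1.le hs.2
          simp [hmem]
      _ ≤ _ := lintegral_mono_set
          (Set.Ioo_subset_Icc_self.trans (Set.Icc_subset_Icc_right htR))
  · exact (hcq.integrableOn_Icc (a := 0) (b := t)).mono_set Set.Ioo_subset_Icc_self
  · exact ae_of_all _ fun s => (abs_nonneg _).trans (hFq _)

end ExitTime

/-! ### Slicing along the first axis and Friedrichs' inequality -/

/-- Forget the first coordinate. -/
noncomputable def dropFirst (x : E3) : EuclideanSpace ℝ (Fin 2) :=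
  WithLp.toLp 2 fun i => x i.succ

lemma lipschitzWith_dropFirst : LipschitzWith 1 dropFirst := by
  refine LipschitzWith.of_dist_le_mul fun x y => ?_
  rw [NNReal.coe_one, one_mul, EuclideanSpace.dist_eq, EuclideanSpace.dist_eq]
  refine Real.sqrt_le_sqrt ?_
  rw [Fin.sum_univ_succ (n := 2)]
  simp only [dropFirst]
  linarith [sq_nonneg (dist (x 0) (y 0))]

lemma measurePreserving_split :
    MeasurePreserving (fun x : E3 => (x 0, dropFirst x)) volume volume := by
  have h1 := PiLp.volume_preserving_ofLp (Fin 3)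
  have h2 := volume_preserving_piFinSuccAbove (fun _ : Fin 3 => ℝ) 0
  have h3 := (MeasurePreserving.id (volume : Measure ℝ)).prod (PiLp.volume_preserving_toLp (Fin 2))
  exact h3.comp (h2.comp h1)

/-- Projections are 1-Lipschitz, hence do not increase two-dimensional Hausdorff measure, which on
the plane is area. -/
lemma volume_image_dropFirst_le (A : Set E3) :
    volume (dropFirst '' A) ≤ (Measure.euclideanHausdorffMeasure 2 : Measure E3) A := by
  have h := EuclideanSpace.euclideanHausdorffMeasure_eq_volume 2
  rw [← h, Measure.euclideanHausdorffMeasure_def, Measure.euclideanHausdorffMeasure_def,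
    Measure.smul_apply, Measure.smul_apply]
  have h2 := lipschitzWith_dropFirst.hausdorffMeasure_image_le (d := 2) (by norm_num) A
  simp only [ENNReal.coe_one, ENNReal.one_rpow, one_mul] at h2
  simp only [Nat.cast_ofNat]
  gcongr

lemma volume_slab_le (I : Set ℝ) (B : Set (EuclideanSpace ℝ (Fin 2))) :
    volume {x : E3 | x 0 ∈ I ∧ dropFirst x ∈ B} ≤ volume I * volume B := by
  calc volume {x : E3 | x 0 ∈ I ∧ dropFirst x ∈ B}
      ≤ volume ((fun x : E3 => (x 0, dropFirst x)) ⁻¹' (toMeasurable volume I ×ˢ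
          toMeasurable volume B)) :=
        measure_mono fun x hx => ⟨subset_toMeasurable _ _ hx.1, subset_toMeasurable _ _ hx.2⟩
    _ = volume (toMeasurable volume I ×ˢ toMeasurable volume B) :=
        measurePreserving_split.measure_preimage
          ((measurableSet_toMeasurable _ _).prod (measurableSet_toMeasurable _ _)).nullMeasurableSet
    _ = volume I * volume B := by
        rw [Measure.volume_eq_prod, Measure.prod_prod, measure_toMeasurable, measure_toMeasurable]

/-- The first coordinate vector. -/
noncomputable def e₁ : E3 := EuclideanSpace.single 0 1

lemma norm_e₁ : ‖e₁‖ = 1 := by simp [e₁]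

lemma dropFirst_sub_smul (x : E3) (s : ℝ) : dropFirst (x - s • e₁) = dropFirst x := by
  ext i
  simp [dropFirst, e₁]

lemma measurable_exitPoint {Ω : Set E3} {R : ℝ} (ho : IsOpen Ω) (hΩ : Ω ⊆ Metric.ball 0 R) :
    Measurable (exitPoint Ω e₁) :=
  measurable_id.sub ((measurable_exitTime ho norm_e₁ hΩ).smul_const _)

/-- The image of Lebesgue measure on `Ω` under the exit map is dominated by surface measure. -/
lemma map_exitPoint_le {Ω : Set E3} {R : ℝ} (ho : IsOpen Ω) (hΩ : Ω ⊆ Metric.ball 0 R) :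
    (vol Ω).map (exitPoint Ω e₁) ≤ ENNReal.ofReal (2 * R) • surf Ω := by
  have hm := measurable_exitPoint ho hΩ
  refine Measure.le_intro fun A hA _ => ?_
  rw [Measure.map_apply hm hA, vol, surf, Measure.restrict_apply (hm hA), Measure.smul_apply,
    Measure.restrict_apply hA, smul_eq_mul]
  -- A point and its exit point have the same projection, so the preimage lies in a cylinder of
  -- height `2R` over the shadow of `A ∩ ∂Ω`.
  calc volume (exitPoint Ω e₁ ⁻¹' A ∩ Ω)
      ≤ volume {x : E3 | x 0 ∈ Set.Ioo (-R) R ∧ dropFirst x ∈ dropFirst '' (A ∩ frontier Ω)} := by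
        refine measure_mono fun x hx => ⟨?_, exitPoint Ω e₁ x,
          ⟨hx.1, exitPoint_mem_frontier ho norm_e₁ hΩ hx.2⟩, dropFirst_sub_smul _ _⟩
        have h1 : ‖x‖ < R := by simpa using hΩ hx.2
        have h2 : |x 0| ≤ ‖x‖ := by simpa using PiLp.norm_apply_le x 0
        exact abs_lt.1 (h2.trans_lt h1)
    _ ≤ volume (Set.Ioo (-R) R) * volume (dropFirst '' (A ∩ frontier Ω)) := volume_slab_le _ _
    _ ≤ _ := by
        rw [Real.volume_Ioo, show R - -R = 2 * R by ring]
        gcongr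
        exact volume_image_dropFirst_le _

/-- The line estimate integrated over `Ω`: the exit term is bounded by pushing the measure forward
to `∂Ω`, the path term by Tonelli and translation invariance, each at the cost of the length `2R`.
-/
lemma lintegral_le_surf_add {Ω : Set E3} {R : ℝ} (ho : IsOpen Ω) (hΩ : Ω ⊆ Metric.ball 0 R)
    {F q : E3 → ℝ} (hF : ContDiff ℝ 1 F)
    (hq : Continuous q) (hFq : ∀ y, |fderiv ℝ F y e₁| ≤ q y) :
    ∫⁻ x, ENNReal.ofReal (F x) ∂(vol Ω) ≤
      ENNReal.ofReal (2 * R) * ∫⁻ x, ENNReal.ofReal (F x) ∂(surf Ω) +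
      ENNReal.ofReal (2 * R) * ∫⁻ x, ENNReal.ofReal (q x) ∂(vol Ω) := by
  have hm := measurable_exitPoint ho hΩ
  have hFm : Measurable fun x => ENNReal.ofReal (F x) := hF.continuous.measurable.ennreal_ofReal
  have hqm : Measurable fun x => ENNReal.ofReal (q x) := hq.measurable.ennreal_ofReal
  set Q : E3 → ℝ≥0∞ := Ω.indicator fun y => ENNReal.ofReal (q y)
  have hQm : Measurable Q := hqm.indicator ho.measurableSet
  have hQ2 : Measurable (Function.uncurry fun (x : E3) (s : ℝ) => Q (x - s • e₁)) :=
    hQm.comp (by fun_prop)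
  calc ∫⁻ x, ENNReal.ofReal (F x) ∂(vol Ω)
      ≤ ∫⁻ x, (ENNReal.ofReal (F (exitPoint Ω e₁ x)) +
          ∫⁻ s in Set.Icc 0 (2 * R), Q (x - s • e₁)) ∂(vol Ω) := by
        refine setLIntegral_mono' ho.measurableSet fun x hx => ?_
        exact ofReal_le_exitPoint_add_lintegral norm_e₁ hΩ hx hF hq hFq
    _ = ∫⁻ y, ENNReal.ofReal (F y) ∂((vol Ω).map (exitPoint Ω e₁)) +
          ∫⁻ s in Set.Icc 0 (2 * R), ∫⁻ x, Q (x - s • e₁) ∂(vol Ω) := by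
        rw [lintegral_add_left (show Measurable fun x => ENNReal.ofReal (F (exitPoint Ω e₁ x)) from
          hFm.comp hm), lintegral_map hFm hm,
          vol, lintegral_lintegral_swap hQ2.aemeasurable]
    _ ≤ ∫⁻ y, ENNReal.ofReal (F y) ∂(ENNReal.ofReal (2 * R) • surf Ω) +
          ∫⁻ s in Set.Icc 0 (2 * R), ∫⁻ x, ENNReal.ofReal (q x) ∂(vol Ω) := by
        refine add_le_add (lintegral_mono' (map_exitPoint_le ho hΩ) le_rfl)
          (lintegral_mono fun s => ?_)
        calc ∫⁻ x, Q (x - s • e₁) ∂(vol Ω) ≤ ∫⁻ x, Q (x - s • e₁) :=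
              lintegral_mono' Measure.restrict_le_self le_rfl
          _ = ∫⁻ x, Q x := lintegral_sub_right_eq_self Q _
          _ = _ := lintegral_indicator ho.measurableSet _
    _ = _ := by
        rw [lintegral_smul_measure, setLIntegral_const, Real.volume_Icc, sub_zero, smul_eq_mul,
          mul_comm (∫⁻ x, ENNReal.ofReal (q x) ∂(vol Ω))]

lemma isFiniteMeasure_vol {Ω : Set E3} (hb : Bornology.IsBounded Ω) : IsFiniteMeasure (vol Ω) :=
  ⟨by rw [vol, Measure.restrict_apply_univ]; exact hb.measure_lt_top⟩

lemma memLp_vol_of_continuous {E : Type*} [NormedAddCommGroup E] [SecondCountableTopology E]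
    {Ω : Set E3} (ho : IsOpen Ω) (hb : Bornology.IsBounded Ω) {u : E3 → E}
    (hu : Continuous u) (p : ℝ≥0∞) : MemLp u p (vol Ω) := by
  have := isFiniteMeasure_vol hb
  obtain ⟨C, hC⟩ := hb.isCompact_closure.exists_bound_of_continuousOn hu.continuousOn
  exact MemLp.of_bound hu.aestronglyMeasurable C
    ((ae_restrict_mem ho.measurableSet).mono fun x hx => hC x (subset_closure hx))

lemma continuous_gradient {v : E3 → ℝ} (hv : ContDiff ℝ ∞ v) : Continuous (gradient v) :=
  (InnerProductSpace.toDual ℝ E3).symm.continuous.comp (hv.continuous_fderiv (by simp))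

/-- Friedrichs' inequality for smooth functions. -/
lemma friedrichs_smooth {Ω : Set E3} {R : ℝ} (hR : 0 < R) (ho : IsOpen Ω)
    (hΩ : Ω ⊆ Metric.ball 0 R) {v : E3 → ℝ} (hv : ContDiff ℝ ∞ v) (hs : MemLp v 2 (surf Ω)) :
    ∫ x, v x ^ 2 ∂(vol Ω) ≤
      16 * R ^ 2 * ∫ x, ‖gradient v x‖ ^ 2 ∂(vol Ω) + 4 * R * ∫ x, v x ^ 2 ∂(surf Ω) := by
  have hb : Bornology.IsBounded Ω := Metric.isBounded_ball.subset hΩ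
  have hg := continuous_gradient hv
  have hvI : Integrable (fun x => v x ^ 2) (vol Ω) :=
    (memLp_vol_of_continuous ho hb hv.continuous 2).integrable_sq
  have hgI : Integrable (fun x => ‖gradient v x‖ ^ 2) (vol Ω) :=
    (memLp_vol_of_continuous ho hb hg 2).norm.integrable_sq
  have hsI := hs.integrable_sq
  -- Young's inequality for `2 |v| ‖∇v‖`, weighted so that after the factor `2R` the `v²` term is
  -- half of the left-hand side and can be absorbed.
  set q : E3 → ℝ := fun x => v x ^ 2 / (4 * R) + 4 * R * ‖gradient v x‖ ^ 2
  have hqI : Integrable q (vol Ω) := (hvI.div_const _).add (hgI.const_mul _)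
  have hq0 : ∀ x, 0 ≤ q x := fun x => by positivity
  have hqc : Continuous q := by
    have := hv.continuous
    fun_prop
  have hFq : ∀ y, |fderiv ℝ (fun x => v x ^ 2) y e₁| ≤ q y := by
    intro y
    have hd : DifferentiableAt ℝ v y := hv.differentiable (by simp) y
    rw [(hd.hasFDerivAt.pow 2).fderiv]
    have h1 : |fderiv ℝ v y e₁| ≤ ‖gradient v y‖ := by
      rw [← inner_gradient_left, ← Real.norm_eq_abs]
      simpa [norm_e₁] using norm_inner_le_norm (𝕜 := ℝ) (gradient v y) e₁
    have h2 : 2 * |v y| * ‖gradient v y‖ ≤ q y := by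
      have h3 : q y - 2 * |v y| * ‖gradient v y‖ =
          (|v y| - 4 * R * ‖gradient v y‖) ^ 2 / (4 * R) := by
        simp only [q]
        rw [← sq_abs (v y)]
        field_simp
        ring
      have h4 : 0 ≤ (|v y| - 4 * R * ‖gradient v y‖) ^ 2 / (4 * R) := by positivity
      linarith
    refine le_trans ?_ h2
    simp only [smul_apply, smul_eq_mul, nsmul_eq_mul, abs_mul]
    simp only [Nat.add_one_sub_one, pow_one, Nat.cast_ofNat, abs_two]
    gcongr
  have h := lintegral_le_surf_add ho hΩ ((hv.pow 2).of_le (by simp)) hqc hFq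
  rw [← ofReal_integral_eq_lintegral_ofReal hvI (ae_of_all _ fun _ => sq_nonneg _),
    ← ofReal_integral_eq_lintegral_ofReal hsI (ae_of_all _ fun _ => sq_nonneg _),
    ← ofReal_integral_eq_lintegral_ofReal hqI (ae_of_all _ hq0),
    ← ENNReal.ofReal_mul (by positivity), ← ENNReal.ofReal_mul (by positivity),
    ← ENNReal.ofReal_add (mul_nonneg (by positivity) (integral_nonneg fun _ => sq_nonneg _))
      (mul_nonneg (by positivity) (integral_nonneg hq0)),
    ENNReal.ofReal_le_ofReal_iff (add_nonneg
      (mul_nonneg (by positivity) (integral_nonneg fun _ => sq_nonneg _))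
      (mul_nonneg (by positivity) (integral_nonneg hq0))),
    integral_add (hvI.div_const _) (hgI.const_mul _), integral_div, integral_const_mul] at h
  have h5 : 2 * R * ((∫ x, v x ^ 2 ∂(vol Ω)) / (4 * R)) = (∫ x, v x ^ 2 ∂(vol Ω)) / 2 := by
    field_simp
    ring
  rw [mul_add, h5] at h
  linarith


/-! ### Passing to limits in `L²` -/

section L2

variable {X : Type*} [MeasurableSpace X] {μ : Measure X}
  {E : Type*} [NormedAddCommGroup E]

/-- An extended norm tending to zero is eventually finite. On `∂Ω` this gives square integrability
of the approximants without finiteness of the surface measure. -/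
lemma eventually_memLp_sub {u : X → E} {v : ℕ → X → E}
    (hm : ∀ k, AEStronglyMeasurable (fun x => v k x - u x) μ)
    (h : Tendsto (fun k => eLpNorm (fun x => v k x - u x) 2 μ) atTop (𝓝 0)) :
    ∀ᶠ k in atTop, MemLp (fun x => v k x - u x) 2 μ := by
  filter_upwards [h.eventually_lt_const ENNReal.zero_lt_top] with k hk
  exact ⟨hm k, hk⟩

lemma eventually_memLp {u : X → E} {v : ℕ → X → E} (hu : MemLp u 2 μ)
    (hm : ∀ k, AEStronglyMeasurable (v k) μ)
    (h : Tendsto (fun k => eLpNorm (fun x => v k x - u x) 2 μ) atTop (𝓝 0)) :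
    ∀ᶠ k in atTop, MemLp (v k) 2 μ := by
  filter_upwards [eventually_memLp_sub (fun k => (hm k).sub hu.1) h] with k hk
  simpa [Pi.add_def] using hk.add hu

lemma tendsto_eLpNorm_sub_sub {u u' : X → E} {v v' : ℕ → X → E} (hu : MemLp u 2 μ)
    (hu' : MemLp u' 2 μ) (hm : ∀ k, AEStronglyMeasurable (v k) μ)
    (hm' : ∀ k, AEStronglyMeasurable (v' k) μ)
    (h : Tendsto (fun k => eLpNorm (fun x => v k x - u x) 2 μ) atTop (𝓝 0))
    (h' : Tendsto (fun k => eLpNorm (fun x => v' k x - u' x) 2 μ) atTop (𝓝 0)) :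
    Tendsto (fun k => eLpNorm (fun x => (v k x - v' k x) - (u x - u' x)) 2 μ) atTop (𝓝 0) := by
  have h0 := h.add h'
  rw [add_zero] at h0
  refine tendsto_of_tendsto_of_tendsto_of_le_of_le tendsto_const_nhds h0 (fun _ => zero_le) ?_
  intro k
  have e : (fun x => (v k x - v' k x) - (u x - u' x)) =
      (fun x => v k x - u x) - fun x => v' k x - u' x := by
    ext x
    simp only [Pi.sub_apply]
    abel
  simp only [e]
  exact eLpNorm_sub_le ((hm k).sub hu.1) ((hm' k).sub hu'.1) (by norm_num)

variable [InnerProductSpace ℝ E]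

lemma integrable_inner_of_memLp {f u : X → E} (hf : MemLp f 2 μ) (hu : MemLp u 2 μ) :
    Integrable (fun x => inner ℝ (f x) (u x)) μ := by
  refine (hf.norm.integrable_mul hu.norm).mono (hf.1.inner hu.1) (ae_of_all _ fun x => ?_)
  simpa using norm_inner_le_norm (𝕜 := ℝ) (f x) (u x)

lemma abs_integral_inner_le {f u : X → E} (hf : MemLp f 2 μ) (hu : MemLp u 2 μ) :
    |∫ x, inner ℝ (f x) (u x) ∂μ| ≤ (eLpNorm f 2 μ).toReal * (eLpNorm u 2 μ).toReal := by
  have h := abs_real_inner_le_norm (hf.toLp f) (hu.toLp u)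
  rw [L2.inner_def, Lp.norm_toLp, Lp.norm_toLp] at h
  convert h using 2
  refine integral_congr_ae ?_
  filter_upwards [hf.coeFn_toLp, hu.coeFn_toLp] with x h1 h2
  rw [h1, h2]

lemma tendsto_integral_inner {f u : X → E} {v : ℕ → X → E} (hf : MemLp f 2 μ) (hu : MemLp u 2 μ)
    (hm : ∀ k, AEStronglyMeasurable (v k) μ)
    (h : Tendsto (fun k => eLpNorm (fun x => v k x - u x) 2 μ) atTop (𝓝 0)) :
    Tendsto (fun k => ∫ x, inner ℝ (f x) (v k x) ∂μ) atTop (𝓝 (∫ x, inner ℝ (f x) (u x) ∂μ)) := by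
  rw [tendsto_iff_dist_tendsto_zero]
  have h0 : Tendsto (fun k => (eLpNorm f 2 μ).toReal *
      (eLpNorm (fun x => v k x - u x) 2 μ).toReal) atTop (𝓝 0) := by
    simpa using ((ENNReal.tendsto_toReal ENNReal.zero_ne_top).comp h).const_mul
      (eLpNorm f 2 μ).toReal
  refine squeeze_zero' (.of_forall fun _ => dist_nonneg) ?_ h0
  filter_upwards [eventually_memLp_sub (fun k => (hm k).sub hu.1) h,
    eventually_memLp hu hm h] with k hk hvk
  rw [Real.dist_eq, ← integral_sub (integrable_inner_of_memLp hf hvk)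
    (integrable_inner_of_memLp hf hu)]
  simp_rw [← inner_sub_right]
  exact abs_integral_inner_le hf hk

lemma tendsto_integral_norm_sq {u : X → E} {v : ℕ → X → E} (hu : MemLp u 2 μ)
    (hm : ∀ k, AEStronglyMeasurable (v k) μ)
    (h : Tendsto (fun k => eLpNorm (fun x => v k x - u x) 2 μ) atTop (𝓝 0)) :
    Tendsto (fun k => ∫ x, ‖v k x‖ ^ 2 ∂μ) atTop (𝓝 (∫ x, ‖u x‖ ^ 2 ∂μ)) := by
  have h1 := tendsto_integral_inner hu hu hm h
  have h2 : Tendsto (fun k => ∫ x, inner ℝ (v k x - u x) (v k x - u x) ∂μ) atTop (𝓝 0) := by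
    have h0 : Tendsto (fun k => (eLpNorm (fun x => v k x - u x) 2 μ).toReal *
        (eLpNorm (fun x => v k x - u x) 2 μ).toReal) atTop (𝓝 0) := by
      have := (ENNReal.tendsto_toReal ENNReal.zero_ne_top).comp h
      simpa using this.mul this
    refine squeeze_zero_norm' ?_ h0
    filter_upwards [eventually_memLp_sub (fun k => (hm k).sub hu.1) h] with k hk
    exact abs_integral_inner_le hk hk
  -- Uses `‖v‖² = ‖v - u‖² + 2⟨u, v⟩ - ‖u‖²`.
  have h3 := h2.add ((h1.const_mul 2).sub_const (∫ x, inner ℝ (u x) (u x) ∂μ))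
  have e1 : 0 + (2 * (∫ x, inner ℝ (u x) (u x) ∂μ) - ∫ x, inner ℝ (u x) (u x) ∂μ) =
      ∫ x, ‖u x‖ ^ 2 ∂μ := by
    simp_rw [real_inner_self_eq_norm_sq]
    ring
  rw [e1] at h3
  refine h3.congr' ?_
  filter_upwards [eventually_memLp_sub (fun k => (hm k).sub hu.1) h,
    eventually_memLp hu hm h] with k hk hvk
  have hi : Integrable (fun x => 2 * inner ℝ (u x) (v k x) - inner ℝ (u x) (u x)) μ :=
    ((integrable_inner_of_memLp hu hvk).const_mul 2).sub (integrable_inner_of_memLp hu hu)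
  rw [← integral_const_mul, ← integral_sub ((integrable_inner_of_memLp hu hvk).const_mul 2)
    (integrable_inner_of_memLp hu hu), ← integral_add (integrable_inner_of_memLp hk hk) hi]
  refine integral_congr_ae (ae_of_all _ fun x => ?_)
  simp only
  rw [inner_sub_sub_self, real_inner_self_eq_norm_sq, real_inner_comm (u x) (v k x)]
  simp
  ring

lemma eLpNorm_two_eq {f : X → ℝ} (hf : MemLp f 2 μ) :
    eLpNorm f 2 μ = ENNReal.ofReal (√(∫ x, f x ^ 2 ∂μ)) := by
  rw [hf.eLpNorm_eq_integral_rpow_norm (by norm_num) (by norm_num), Real.sqrt_eq_rpow]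
  simp

end L2

/-! ### Friedrichs' inequality and weak identities for `H¹` functions with traces -/

/-- The smooth functions `v k` converge in `H¹(Ω)` to `u`, with gradient `G`, and their boundary
values converge in `L²(∂Ω)` to `τ`. -/
structure SmoothApprox (Ω : Set E3) (u : E3 → ℝ) (G : E3 → E3) (τ : E3 → ℝ)
    (v : ℕ → E3 → ℝ) : Prop where
  memLp : MemLp u 2 (vol Ω)
  memLp_grad : MemLp G 2 (vol Ω)
  memLp_trace : MemLp τ 2 (surf Ω)
  smooth : ∀ k, ContDiff ℝ ∞ (v k)
  tendsto : Tendsto (fun k => eLpNorm (fun x => v k x - u x) 2 (vol Ω)) atTop (𝓝 0)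
  tendsto_grad : Tendsto (fun k => eLpNorm (fun x => gradient (v k) x - G x) 2 (vol Ω)) atTop (𝓝 0)
  tendsto_trace : Tendsto (fun k => eLpNorm (fun x => v k x - τ x) 2 (surf Ω)) atTop (𝓝 0)

lemma exists_smoothApprox {Ω : Set E3} {u : E3 → ℝ} {G : E3 → E3} {τ : E3 → ℝ}
    (hu : MemH1 Ω u G) (hτ : IsTrace Ω u G τ) : ∃ v, SmoothApprox Ω u G τ v := by
  obtain ⟨hτ2, v, hv, h1, h2, h3⟩ := hτ
  exact ⟨v, hu.memLp, hu.memLp_grad, hτ2, hv, h1, h2, h3⟩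

namespace SmoothApprox

variable {Ω : Set E3} {u u' τ τ' : E3 → ℝ} {G G' : E3 → E3} {v v' : ℕ → E3 → ℝ}

lemma sub (h : SmoothApprox Ω u G τ v) (h' : SmoothApprox Ω u' G' τ' v') :
    SmoothApprox Ω (fun x => u x - u' x) (fun x => G x - G' x) (fun x => τ x - τ' x)
      (fun k x => v k x - v' k x) where
  memLp := h.memLp.sub h'.memLp
  memLp_grad := h.memLp_grad.sub h'.memLp_grad
  memLp_trace := h.memLp_trace.sub h'.memLp_trace
  smooth k := (h.smooth k).sub (h'.smooth k)
  tendsto := tendsto_eLpNorm_sub_sub h.memLp h'.memLp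
    (fun k => (h.smooth k).continuous.aestronglyMeasurable)
    (fun k => (h'.smooth k).continuous.aestronglyMeasurable) h.tendsto h'.tendsto
  tendsto_grad := by
    have e : ∀ k, gradient (fun x => v k x - v' k x) =
        fun x => gradient (v k) x - gradient (v' k) x := by
      intro k
      ext1 x
      simp only [gradient]
      rw [fderiv_fun_sub ((h.smooth k).differentiable (by simp) x)
        ((h'.smooth k).differentiable (by simp) x), map_sub]
    simp only [e]
    exact tendsto_eLpNorm_sub_sub h.memLp_grad h'.memLp_grad
      (fun k => (continuous_gradient (h.smooth k)).aestronglyMeasurable)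
      (fun k => (continuous_gradient (h'.smooth k)).aestronglyMeasurable)
      h.tendsto_grad h'.tendsto_grad
  tendsto_trace := tendsto_eLpNorm_sub_sub h.memLp_trace h'.memLp_trace
    (fun k => (h.smooth k).continuous.aestronglyMeasurable)
    (fun k => (h'.smooth k).continuous.aestronglyMeasurable) h.tendsto_trace h'.tendsto_trace

lemma eventually_memLp_trace (h : SmoothApprox Ω u G τ v) :
    ∀ᶠ k in atTop, MemLp (v k) 2 (surf Ω) :=
  eventually_memLp h.memLp_trace (fun k => (h.smooth k).continuous.aestronglyMeasurable)
    h.tendsto_trace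

/-- Friedrichs' inequality. -/
lemma friedrichs {R : ℝ} (hR : 0 < R) (ho : IsOpen Ω) (hΩ : Ω ⊆ Metric.ball 0 R)
    (h : SmoothApprox Ω u G τ v) :
    ∫ x, u x ^ 2 ∂(vol Ω) ≤
      16 * R ^ 2 * ∫ x, ‖G x‖ ^ 2 ∂(vol Ω) + 4 * R * ∫ x, τ x ^ 2 ∂(surf Ω) := by
  have h1 := tendsto_integral_norm_sq h.memLp
    (fun k => (h.smooth k).continuous.aestronglyMeasurable) h.tendsto
  have h2 := tendsto_integral_norm_sq h.memLp_grad
    (fun k => (continuous_gradient (h.smooth k)).aestronglyMeasurable) h.tendsto_grad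
  have h3 := tendsto_integral_norm_sq h.memLp_trace
    (fun k => (h.smooth k).continuous.aestronglyMeasurable) h.tendsto_trace
  simp only [Real.norm_eq_abs, sq_abs] at h1 h3
  refine le_of_tendsto_of_tendsto h1 ((h2.const_mul _).add (h3.const_mul _)) ?_
  filter_upwards [h.eventually_memLp_trace] with k hk
  exact friedrichs_smooth hR ho hΩ (h.smooth k) hk

/-- A weak formulation tested against smooth functions may be tested against `H¹` functions. -/
lemma weak_identity (h : SmoothApprox Ω u G τ v) {A : E3 → E3} {b c : E3 → ℝ}
    (hA : MemLp A 2 (vol Ω)) (hb : MemLp b 2 (vol Ω)) (hc : MemLp c 2 (surf Ω))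
    (hw : ∀ w : E3 → ℝ, ContDiff ℝ ∞ w → MemLp w 2 (surf Ω) →
      ∫ x, inner ℝ (A x) (gradient w x) ∂(vol Ω) + ∫ x, b x * w x ∂(vol Ω)
        + ∫ x, c x * w x ∂(surf Ω) = 0) :
    ∫ x, inner ℝ (A x) (G x) ∂(vol Ω) + ∫ x, b x * u x ∂(vol Ω)
        + ∫ x, c x * τ x ∂(surf Ω) = 0 := by
  have h1 := tendsto_integral_inner hb h.memLp
    (fun k => (h.smooth k).continuous.aestronglyMeasurable) h.tendsto
  have h2 := tendsto_integral_inner hA h.memLp_grad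
    (fun k => (continuous_gradient (h.smooth k)).aestronglyMeasurable) h.tendsto_grad
  have h3 := tendsto_integral_inner hc h.memLp_trace
    (fun k => (h.smooth k).continuous.aestronglyMeasurable) h.tendsto_trace
  simp only [Real.inner_apply] at h1 h3
  refine tendsto_nhds_unique ((h2.add h1).add h3) ?_
  refine tendsto_const_nhds.congr' ?_
  filter_upwards [h.eventually_memLp_trace] with k hk
  exact (hw _ (h.smooth k) hk).symm

end SmoothApprox


/-! ### Coefficient bounds and the energy estimate -/

lemma memLp_smul_of_bounded {X E : Type*} [MeasurableSpace X] {μ : Measure X}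
    [NormedAddCommGroup E] [NormedSpace ℝ E] {a : X → ℝ} {u : X → E} {C : ℝ}
    (ha : AEStronglyMeasurable a μ) (haC : ∀ᵐ x ∂μ, |a x| ≤ C) (hu : MemLp u 2 μ) :
    MemLp (fun x => a x • u x) 2 μ := by
  refine hu.of_le_mul (c := C) (ha.smul hu.1) ?_
  filter_upwards [haC] with x hx
  rw [norm_smul, Real.norm_eq_abs]
  gcongr

lemma kappa_pos {g : ℝ} : 0 < kappa g := by
  have : 0 < 1 + g + g ^ 2 := by nlinarith [sq_nonneg (1 + 2 * g)]
  unfold kappa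
  positivity

/-- Follows from `1 + g + g² < 3`. It keeps the weight `κ` of the second equation away from zero,
uniformly in `g`. -/
lemma one_seventh_le_kappa {g : ℝ} (h1 : -1 < g) (h2 : g < 1) : 1 / 7 ≤ kappa g := by
  have h0 : 0 < 1 + g + g ^ 2 := by nlinarith [sq_nonneg (1 + 2 * g)]
  rw [kappa, div_le_div_iff₀ (by norm_num) (by positivity)]
  nlinarith

lemma kappa'_pos {g : ℝ} (h1 : -1 < g) : 0 < kappa' g := by
  have : 0 < 1 + g := by linarith
  have := kappa_pos (g := g)
  unfold kappa'
  positivity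

lemma one_div_diffCoeff (g : ℝ) (σs : E3 → ℝ) (x : E3) :
    1 / diffCoeff g σs x = 3 * (1 - g) * σs x := by
  rw [diffCoeff, one_div_one_div]

/-- Subtracting two weak formulations with the same right-hand side. -/
lemma weak_sub {Ω : Set E3} (ho : IsOpen Ω) (hbd : Bornology.IsBounded Ω)
    {d b b' c c' w : E3 → ℝ} {G G' : E3 → E3} {r : ℝ}
    (hG : MemLp (fun x => d x • G x) 2 (vol Ω)) (hG' : MemLp (fun x => d x • G' x) 2 (vol Ω))
    (hb : MemLp b 2 (vol Ω)) (hb' : MemLp b' 2 (vol Ω))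
    (hc : MemLp c 2 (surf Ω)) (hc' : MemLp c' 2 (surf Ω))
    (hw : ContDiff ℝ ∞ w) (hws : MemLp w 2 (surf Ω))
    (h : (∫ x, d x * inner ℝ (G x) (gradient w x) ∂(vol Ω)) + (∫ x, b x * w x ∂(vol Ω))
      + (∫ x, c x * w x ∂(surf Ω)) = r)
    (h' : (∫ x, d x * inner ℝ (G' x) (gradient w x) ∂(vol Ω)) + (∫ x, b' x * w x ∂(vol Ω))
      + (∫ x, c' x * w x ∂(surf Ω)) = r) :
    ∫ x, inner ℝ (d x • (G x - G' x)) (gradient w x) ∂(vol Ω) + ∫ x, (b x - b' x) * w x ∂(vol Ω)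
      + ∫ x, (c x - c' x) * w x ∂(surf Ω) = 0 := by
  have hwv := memLp_vol_of_continuous ho hbd hw.continuous 2
  have hgv := memLp_vol_of_continuous ho hbd (continuous_gradient hw) 2
  have i1 := integrable_inner_of_memLp hG hgv
  have i2 := integrable_inner_of_memLp hG' hgv
  simp only [real_inner_smul_left] at i1 i2
  simp only [sub_mul, smul_sub, inner_sub_left, real_inner_smul_left]
  have i3 : Integrable (fun x => b x * w x) (vol Ω) := hb.integrable_mul hwv
  have i4 : Integrable (fun x => b' x * w x) (vol Ω) := hb'.integrable_mul hwv
  have i5 : Integrable (fun x => c x * w x) (surf Ω) := hc.integrable_mul hws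
  have i6 : Integrable (fun x => c' x * w x) (surf Ω) := hc'.integrable_mul hws
  rw [integral_sub i1 i2, integral_sub i3 i4, integral_sub i5 i6]
  -- Both source terms are the same number `r`, so they cancel without any integrability of the
  -- source.
  linarith

/-- The energy estimate for the difference of two solutions. -/
lemma energy_estimate {Ω : Set E3} {h P w₁ w₂ τ₁ τ₂ d : E3 → ℝ} {G₁ G₂ : E3 → E3}
    {k d₀ m C₁ C₂ : ℝ} (hd₀ : 0 < d₀) (hm : 0 < m) (hk : 1 / 7 ≤ k)
    (hd : ∀ᵐ x ∂(vol Ω), d₀ ≤ d x) (hP : ∀ᵐ x ∂(vol Ω), 0 ≤ P x)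
    (hmC₁ : m * C₁ ≤ d₀ / 7) (hmC₂ : m * C₂ ≤ 1 / 6)
    (hh : MemLp h 2 (vol Ω)) (hPw : MemLp (fun x => P x * w₂ x) 2 (vol Ω))
    (hw₁ : MemLp w₁ 2 (vol Ω)) (hw₂ : MemLp w₂ 2 (vol Ω))
    (hG₁ : MemLp G₁ 2 (vol Ω)) (hG₂ : MemLp G₂ 2 (vol Ω))
    (hdG₁ : MemLp (fun x => d x • G₁ x) 2 (vol Ω)) (hdG₂ : MemLp (fun x => d x • G₂ x) 2 (vol Ω))
    (hτ₁ : MemLp τ₁ 2 (surf Ω)) (hτ₂ : MemLp τ₂ 2 (surf Ω))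
    (hF₁ : ∫ x, w₁ x ^ 2 ∂(vol Ω) ≤
      C₁ * ∫ x, ‖G₁ x‖ ^ 2 ∂(vol Ω) + C₂ * ∫ x, τ₁ x ^ 2 ∂(surf Ω))
    (hF₂ : ∫ x, w₂ x ^ 2 ∂(vol Ω) ≤
      C₁ * ∫ x, ‖G₂ x‖ ^ 2 ∂(vol Ω) + C₂ * ∫ x, τ₂ x ^ 2 ∂(surf Ω))
    (hI₁ : ∫ x, inner ℝ (d x • G₁ x) (G₁ x) ∂(vol Ω) + ∫ x, h x * w₁ x ∂(vol Ω)
      + ∫ x, (1 / 2 * τ₁ x - 1 / 8 * τ₂ x) * τ₁ x ∂(surf Ω) = 0)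
    (hI₂ : ∫ x, inner ℝ (d x • G₂ x) (G₂ x) ∂(vol Ω)
      + ∫ x, (P x * w₂ x - 2 / (3 * k) * h x) * w₂ x ∂(vol Ω)
      + ∫ x, (7 / (24 * k) * τ₂ x - 1 / (8 * k) * τ₁ x) * τ₂ x ∂(surf Ω) = 0) :
    ∫ x, w₁ x ^ 2 ∂(vol Ω) + ∫ x, w₂ x ^ 2 ∂(vol Ω) ≤ 2 / m ^ 2 * ∫ x, h x ^ 2 ∂(vol Ω) := by
  have hk0 : 0 < k := lt_of_lt_of_le (by norm_num) hk
  have grad : ∀ {G : E3 → E3}, MemLp G 2 (vol Ω) → MemLp (fun x => d x • G x) 2 (vol Ω) →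
      d₀ * ∫ x, ‖G x‖ ^ 2 ∂(vol Ω) ≤ ∫ x, inner ℝ (d x • G x) (G x) ∂(vol Ω) := by
    intro G hG hdG
    rw [← integral_const_mul]
    refine integral_mono_ae (hG.norm.integrable_sq.const_mul _)
      (integrable_inner_of_memLp hdG hG) ?_
    filter_upwards [hd] with x hx
    rw [real_inner_smul_left, real_inner_self_eq_norm_sq]
    gcongr
  have hA₁ := grad hG₁ hdG₁
  have hA₂ := grad hG₂ hdG₂
  have hA₂0 : 0 ≤ ∫ x, ‖G₂ x‖ ^ 2 ∂(vol Ω) := integral_nonneg fun _ => by positivity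
  have hA₁0 : 0 ≤ ∫ x, ‖G₁ x‖ ^ 2 ∂(vol Ω) := integral_nonneg fun _ => by positivity
  have hT₁0 : 0 ≤ ∫ x, τ₁ x ^ 2 ∂(surf Ω) := integral_nonneg fun _ => by positivity
  have hT₂0 : 0 ≤ ∫ x, τ₂ x ^ 2 ∂(surf Ω) := integral_nonneg fun _ => by positivity
  -- The weight `k` makes the cross terms equal; the difference of the two sides is exactly `(1/8) ∫
  -- (τ₁ - τ₂)²`.
  have hsurf : 3 / 8 * ∫ x, τ₁ x ^ 2 ∂(surf Ω) + 1 / 6 * ∫ x, τ₂ x ^ 2 ∂(surf Ω) ≤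
      ∫ x, (1 / 2 * τ₁ x - 1 / 8 * τ₂ x) * τ₁ x ∂(surf Ω)
      + k * ∫ x, (7 / (24 * k) * τ₂ x - 1 / (8 * k) * τ₁ x) * τ₂ x ∂(surf Ω) := by
    have j1 : Integrable (fun x => (1 / 2 * τ₁ x - 1 / 8 * τ₂ x) * τ₁ x) (surf Ω) :=
      ((hτ₁.const_mul _).sub (hτ₂.const_mul _)).integrable_mul hτ₁
    have j2 : Integrable (fun x => (7 / (24 * k) * τ₂ x - 1 / (8 * k) * τ₁ x) * τ₂ x) (surf Ω) :=
      ((hτ₂.const_mul _).sub (hτ₁.const_mul _)).integrable_mul hτ₂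
    rw [← integral_const_mul, ← integral_const_mul, ← integral_const_mul,
      ← integral_add (hτ₁.integrable_sq.const_mul _) (hτ₂.integrable_sq.const_mul _),
      ← integral_add j1 (j2.const_mul k)]
    refine integral_mono ((hτ₁.integrable_sq.const_mul _).add (hτ₂.integrable_sq.const_mul _))
      (j1.add (j2.const_mul k)) fun x => ?_
    have e : (1 / 2 * τ₁ x - 1 / 8 * τ₂ x) * τ₁ x
        + k * ((7 / (24 * k) * τ₂ x - 1 / (8 * k) * τ₁ x) * τ₂ x) =
        1 / 2 * τ₁ x ^ 2 - 1 / 4 * τ₁ x * τ₂ x + 7 / 24 * τ₂ x ^ 2 := by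
      field_simp
      ring
    simp only [e]
    nlinarith [sq_nonneg (τ₁ x - τ₂ x)]
  -- The term `k P w₂²` is discarded as nonnegative, and completing squares in `h w₁ - (2/3) h w₂`
  -- leaves the surplus `(5/18) h² / m`.
  have hvol : -(m / 2 * (∫ x, w₁ x ^ 2 ∂(vol Ω) + ∫ x, w₂ x ^ 2 ∂(vol Ω))
      + 1 / m * ∫ x, h x ^ 2 ∂(vol Ω)) ≤
      ∫ x, h x * w₁ x ∂(vol Ω)
      + k * ∫ x, (P x * w₂ x - 2 / (3 * k) * h x) * w₂ x ∂(vol Ω) := by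
    have j1 : Integrable (fun x => h x * w₁ x) (vol Ω) := hh.integrable_mul hw₁
    have j2 : Integrable (fun x => (P x * w₂ x - 2 / (3 * k) * h x) * w₂ x) (vol Ω) :=
      (hPw.sub (hh.const_mul _)).integrable_mul hw₂
    have j3 : Integrable (fun x => w₁ x ^ 2 + w₂ x ^ 2) (vol Ω) :=
      hw₁.integrable_sq.add hw₂.integrable_sq
    rw [← integral_add hw₁.integrable_sq hw₂.integrable_sq, ← integral_const_mul,
      ← integral_const_mul, ← integral_const_mul,
      ← integral_add (j3.const_mul _) (hh.integrable_sq.const_mul _), ← integral_neg,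
      ← integral_add j1 (j2.const_mul k)]
    refine integral_mono_ae ((j3.const_mul _).add (hh.integrable_sq.const_mul _)).neg
      (j1.add (j2.const_mul k)) ?_
    filter_upwards [hP] with x hx
    have e : h x * w₁ x + k * ((P x * w₂ x - 2 / (3 * k) * h x) * w₂ x) =
        h x * w₁ x + k * P x * w₂ x ^ 2 - 2 / 3 * h x * w₂ x := by
      field_simp
      ring
    have e2 : h x * w₁ x - 2 / 3 * h x * w₂ x +
        (m / 2 * (w₁ x ^ 2 + w₂ x ^ 2) + 1 / m * h x ^ 2) =
        (m * w₁ x + h x) ^ 2 / (2 * m) + (m * w₂ x - 2 / 3 * h x) ^ 2 / (2 * m)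
          + 5 / 18 * h x ^ 2 / m := by
      field_simp
      ring
    have e3 : 0 ≤ (m * w₁ x + h x) ^ 2 / (2 * m) + (m * w₂ x - 2 / 3 * h x) ^ 2 / (2 * m)
          + 5 / 18 * h x ^ 2 / m := by positivity
    have e4 : 0 ≤ k * P x * w₂ x ^ 2 := by positivity
    simp only [e]
    linarith
  set A₁ := ∫ x, ‖G₁ x‖ ^ 2 ∂(vol Ω)
  set A₂ := ∫ x, ‖G₂ x‖ ^ 2 ∂(vol Ω)
  set T₁ := ∫ x, τ₁ x ^ 2 ∂(surf Ω)
  set T₂ := ∫ x, τ₂ x ^ 2 ∂(surf Ω)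
  set N₁ := ∫ x, w₁ x ^ 2 ∂(vol Ω)
  set N₂ := ∫ x, w₂ x ^ 2 ∂(vol Ω)
  set S := ∫ x, h x ^ 2 ∂(vol Ω)
  -- By the choice of `m`, the energy dominates `m (N₁ + N₂)`. The factor `1/7` in `hmC₁` is there
  -- for `b₂`, where the gradient term carries only the weight `k ≥ 1/7`.
  have b₁ : m * N₁ ≤ d₀ * A₁ + 3 / 8 * T₁ := by
    have := mul_le_mul_of_nonneg_left hF₁ hm.le
    nlinarith [mul_le_mul_of_nonneg_right hmC₁ hA₁0, mul_le_mul_of_nonneg_right hmC₂ hT₁0,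
      mul_nonneg hd₀.le hA₁0]
  have b₂ : m * N₂ ≤ k * (d₀ * A₂) + 1 / 6 * T₂ := by
    have := mul_le_mul_of_nonneg_left hF₂ hm.le
    nlinarith [mul_le_mul_of_nonneg_right hmC₁ hA₂0, mul_le_mul_of_nonneg_right hmC₂ hT₂0,
      mul_le_mul_of_nonneg_right hk (mul_nonneg hd₀.le hA₂0)]
  have b₃ := mul_le_mul_of_nonneg_left hA₂ hk0.le
  have b₄ : k * (∫ x, inner ℝ (d x • G₂ x) (G₂ x) ∂(vol Ω)) +
      k * (∫ x, (P x * w₂ x - 2 / (3 * k) * h x) * w₂ x ∂(vol Ω))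
      + k * (∫ x, (7 / (24 * k) * τ₂ x - 1 / (8 * k) * τ₁ x) * τ₂ x ∂(surf Ω)) = 0 := by
    rw [← mul_add, ← mul_add, hI₂, mul_zero]
  have b₅ : m / 2 * (N₁ + N₂) ≤ 1 / m * S := by linarith
  -- In `b₅`, half of `m (N₁ + N₂)` has been absorbed.
  have b₆ : N₁ + N₂ = 2 / m * (m / 2 * (N₁ + N₂)) := by
    field_simp
  rw [b₆, show 2 / m ^ 2 * S = 2 / m * (1 / m * S) by field_simp]
  gcongr


/-! ### Stability of the fields and of the absorption coefficient -/

lemma ae_vol_of_forall {Ω : Set E3} (ho : IsOpen Ω) {p : E3 → Prop} (h : ∀ x ∈ Ω, p x) :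
    ∀ᵐ x ∂(vol Ω), p x :=
  (ae_restrict_mem ho.measurableSet).mono h

lemma ae_abs_le {Ω : Set E3} (ho : IsOpen Ω) {α β : ℝ} (hα : 0 < α) {a : E3 → ℝ}
    (ha : ∀ x ∈ Ω, α ≤ a x ∧ a x ≤ β) : ∀ᵐ x ∂(vol Ω), |a x| ≤ β :=
  ae_vol_of_forall ho fun x hx => by
    rw [abs_of_pos (hα.trans_le (ha x hx).1)]
    exact (ha x hx).2

/-- The fields `φ₁ - φ₁'` and `φ₂ - φ₂'` are controlled by the difference of the absorbed
energies. -/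
lemma solution_sub_estimate {Ω : Set E3} {R α β g m : ℝ} {σa σa' σs f φ₁ φ₂ φ₁' φ₂' : E3 → ℝ}
    (hR : 0 < R) (ho : IsOpen Ω) (hΩ : Ω ⊆ Metric.ball 0 R) (hα : 0 < α) (hαβ : α ≤ β)
    (hg₁ : -1 < g) (hg₂ : g < 1) (hm : 0 < m)
    (hm₁ : m * (16 * R ^ 2) ≤ 1 / (6 * β) / 7) (hm₂ : m * (4 * R) ≤ 1 / 6)
    (hσs : AEStronglyMeasurable σs (vol Ω)) (hσsb : ∀ x ∈ Ω, α ≤ σs x ∧ σs x ≤ β)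
    (hσa : AEStronglyMeasurable σa (vol Ω)) (hσab : ∀ x ∈ Ω, α ≤ σa x ∧ σa x ≤ β)
    (hσa' : AEStronglyMeasurable σa' (vol Ω)) (hσab' : ∀ x ∈ Ω, α ≤ σa' x ∧ σa' x ≤ β)
    (hs : IsSolution Ω g σa σs f φ₁ φ₂) (hs' : IsSolution Ω g σa' σs f φ₁' φ₂') :
    ∫ x, (φ₁ x - φ₁' x) ^ 2 ∂(vol Ω) + ∫ x, (φ₂ x - φ₂' x) ^ 2 ∂(vol Ω) ≤
      2 / m ^ 2 * ∫ x, (σa x * (φ₁ x - 2 / 3 * φ₂ x) - σa' x * (φ₁' x - 2 / 3 * φ₂' x)) ^ 2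
        ∂(vol Ω) := by
  have hb : Bornology.IsBounded Ω := Metric.isBounded_ball.subset hΩ
  have hβ : 0 < β := hα.trans_le hαβ
  obtain ⟨G₁, G₂, τ₁, τ₂, hφ₁, hφ₂, hτ₁, hτ₂, hE₁, hE₂⟩ := hs
  obtain ⟨G₁', G₂', τ₁', τ₂', hφ₁', hφ₂', hτ₁', hτ₂', hE₁', hE₂'⟩ := hs'
  obtain ⟨v₁, ha₁⟩ := exists_smoothApprox hφ₁ hτ₁
  obtain ⟨v₂, ha₂⟩ := exists_smoothApprox hφ₂ hτ₂
  obtain ⟨v₁', ha₁'⟩ := exists_smoothApprox hφ₁' hτ₁'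
  obtain ⟨v₂', ha₂'⟩ := exists_smoothApprox hφ₂' hτ₂'
  have s₁ := ha₁.sub ha₁'
  have s₂ := ha₂.sub ha₂'
  have hg : 0 < 1 - g := by linarith
  have hk := one_seventh_le_kappa hg₁ hg₂
  have hk0 := kappa_pos (g := g)
  have hk' := kappa'_pos hg₁
  have hDm : AEStronglyMeasurable (diffCoeff g σs) (vol Ω) :=
    ((hσs.aemeasurable.const_mul (3 * (1 - g))).const_div 1).aestronglyMeasurable
  -- Since `1 - g < 2`, this lower bound does not depend on `g`. The upper bounds on `D` and `P`
  -- below do depend on `g`, but serve only to place products in `L²`.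
  have hDlow : ∀ᵐ x ∂(vol Ω), 1 / (6 * β) ≤ diffCoeff g σs x := by
    refine ae_vol_of_forall ho fun x hx => ?_
    have hsx := hσsb x hx
    have hsx0 : 0 < σs x := hα.trans_le hsx.1
    refine one_div_le_one_div_of_le (by positivity) ?_
    nlinarith [mul_pos (show 0 < 1 + g by linarith) hsx0]
  have hDup : ∀ᵐ x ∂(vol Ω), |diffCoeff g σs x| ≤ 1 / (3 * (1 - g) * α) := by
    refine ae_vol_of_forall ho fun x hx => ?_
    have hsx := hσsb x hx
    have hsx0 : 0 < σs x := hα.trans_le hsx.1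
    rw [diffCoeff, abs_of_pos (by positivity)]
    exact one_div_le_one_div_of_le (by positivity) (by gcongr; exact hsx.1)
  set P : E3 → ℝ := fun x => 5 / (9 * kappa' g) * (1 / diffCoeff g σs x)
  have hPeq : P = fun x => 5 / (9 * kappa' g) * (3 * (1 - g) * σs x) := by
    ext x
    simp only [P, one_div_diffCoeff]
  have hPm : AEStronglyMeasurable P (vol Ω) := by
    rw [hPeq]
    exact (hσs.const_mul _).const_mul _
  have hP0 : ∀ᵐ x ∂(vol Ω), 0 ≤ P x := by
    refine ae_vol_of_forall ho fun x hx => ?_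
    have hsx0 : 0 < σs x := hα.trans_le (hσsb x hx).1
    rw [hPeq]
    positivity
  have hPup : ∀ᵐ x ∂(vol Ω), |P x| ≤ 5 / (9 * kappa' g) * (3 * (1 - g) * β) := by
    refine ae_vol_of_forall ho fun x hx => ?_
    have hsx := hσsb x hx
    have hsx0 : 0 < σs x := hα.trans_le hsx.1
    rw [hPeq]
    simp only
    rw [abs_of_pos (by positivity)]
    gcongr
    exact hsx.2
  have hσβ := ae_abs_le ho hα hσab
  have hσβ' := ae_abs_le ho hα hσab'
  have dG : ∀ {G : E3 → E3}, MemLp G 2 (vol Ω) →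
      MemLp (fun x => diffCoeff g σs x • G x) 2 (vol Ω) := memLp_smul_of_bounded hDm hDup
  have b₁ : ∀ {σ u₁ u₂ : E3 → ℝ}, AEStronglyMeasurable σ (vol Ω) → (∀ᵐ x ∂(vol Ω), |σ x| ≤ β) →
      MemLp u₁ 2 (vol Ω) → MemLp u₂ 2 (vol Ω) →
      MemLp (fun x => σ x * u₁ x - 2 / 3 * σ x * u₂ x) 2 (vol Ω) := by
    intro σ u₁ u₂ h1 h2 h3 h4
    have h5 := (memLp_smul_of_bounded h1 h2 h4).const_mul (2 / 3)
    have h6 := (memLp_smul_of_bounded h1 h2 h3).sub h5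
    simp only [smul_eq_mul, ← mul_assoc] at h6
    exact h6
  have b₂ : ∀ {σ u₁ u₂ : E3 → ℝ}, AEStronglyMeasurable σ (vol Ω) → (∀ᵐ x ∂(vol Ω), |σ x| ≤ β) →
      MemLp u₁ 2 (vol Ω) → MemLp u₂ 2 (vol Ω) →
      MemLp (fun x => (P x + 4 / (9 * kappa g) * σ x) * u₂ x - 2 / (3 * kappa g) * σ x * u₁ x) 2
        (vol Ω) := by
    intro σ u₁ u₂ h1 h2 h3 h4
    -- The zero-order term of the second equation is `P u₂` minus `2/(3κ)` times that of the first.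
    have h5 := (memLp_smul_of_bounded hPm hPup h4).sub
      ((b₁ h1 h2 h3 h4).const_mul (2 / (3 * kappa g)))
    convert h5 using 1
    ext x
    simp only [Pi.sub_apply, smul_eq_mul]
    field_simp
    ring
  have c₁ : ∀ {t₁ t₂ : E3 → ℝ}, MemLp t₁ 2 (surf Ω) → MemLp t₂ 2 (surf Ω) → ∀ p q : ℝ,
      MemLp (fun x => p * t₁ x - q * t₂ x) 2 (surf Ω) :=
    fun h1 h2 p q => (h1.const_mul p).sub (h2.const_mul q)
  have hb₁ := b₁ hσa hσβ hφ₁.memLp hφ₂.memLp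
  have hb₁' := b₁ hσa' hσβ' hφ₁'.memLp hφ₂'.memLp
  have hb₂ := b₂ hσa hσβ hφ₁.memLp hφ₂.memLp
  have hb₂' := b₂ hσa' hσβ' hφ₁'.memLp hφ₂'.memLp
  have hc₁ := c₁ hτ₁.1 hτ₂.1 (1 / 2) (1 / 8)
  have hc₁' := c₁ hτ₁'.1 hτ₂'.1 (1 / 2) (1 / 8)
  have hc₂ := c₁ hτ₂.1 hτ₁.1 (7 / (24 * kappa g)) (1 / (8 * kappa g))
  have hc₂' := c₁ hτ₂'.1 hτ₁'.1 (7 / (24 * kappa g)) (1 / (8 * kappa g))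
  have I₁ := s₁.weak_identity (dG s₁.memLp_grad) (hb₁.sub hb₁') (hc₁.sub hc₁')
    fun w hw hws => weak_sub ho hb (dG hφ₁.memLp_grad) (dG hφ₁'.memLp_grad) hb₁ hb₁' hc₁ hc₁'
      hw hws (hE₁ w hw) (hE₁' w hw)
  have I₂ := s₂.weak_identity (dG s₂.memLp_grad) (hb₂.sub hb₂') (hc₂.sub hc₂')
    fun w hw hws => weak_sub ho hb (dG hφ₂.memLp_grad) (dG hφ₂'.memLp_grad) hb₂ hb₂' hc₂ hc₂'
      hw hws (hE₂ w hw) (hE₂' w hw)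
  have hheq : (fun x => σa x * (φ₁ x - 2 / 3 * φ₂ x) - σa' x * (φ₁' x - 2 / 3 * φ₂' x)) =
      fun x => (σa x * φ₁ x - 2 / 3 * σa x * φ₂ x) - (σa' x * φ₁' x - 2 / 3 * σa' x * φ₂' x) := by
    ext x
    ring
  have hh : MemLp (fun x => σa x * (φ₁ x - 2 / 3 * φ₂ x) - σa' x * (φ₁' x - 2 / 3 * φ₂' x)) 2
      (vol Ω) := by
    rw [hheq]
    exact hb₁.sub hb₁'
  have hPw : MemLp (fun x => P x * (φ₂ x - φ₂' x)) 2 (vol Ω) :=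
    memLp_smul_of_bounded hPm hPup s₂.memLp
  refine energy_estimate (P := P) (k := kappa g) (d₀ := 1 / (6 * β)) (by positivity) hm hk hDlow
    hP0 hm₁ hm₂ hh hPw s₁.memLp s₂.memLp s₁.memLp_grad
    s₂.memLp_grad (dG s₁.memLp_grad) (dG s₂.memLp_grad) s₁.memLp_trace s₂.memLp_trace
    (s₁.friedrichs hR ho hΩ) (s₂.friedrichs hR ho hΩ) ?_ ?_
  -- The absorption coefficients now disappear into `h`: the zero-order terms of the differences are
  -- `h` and `P w₂ - 2/(3κ) h`.
  · refine Eq.trans (congrArg₂ (· + ·) (congrArg₂ (· + ·) rfl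
      (integral_congr_ae (ae_of_all _ fun x => ?_)))
      (integral_congr_ae (ae_of_all _ fun x => ?_))) I₁ <;>
    · simp only [Pi.sub_apply]
      ring
  · refine Eq.trans (congrArg₂ (· + ·) (congrArg₂ (· + ·) rfl
      (integral_congr_ae (ae_of_all _ fun x => ?_)))
      (integral_congr_ae (ae_of_all _ fun x => ?_))) I₂ <;>
    · simp only [Pi.sub_apply]
      field_simp
      ring

/-- If the fields depend stably on the absorbed energy, then so does the absorption coefficient. -/
lemma coefficient_estimate {X : Type*} [MeasurableSpace X] {μ : Measure X} {α β K : ℝ}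
    {Ξ σ σ' u₁ u₂ u₁' u₂' : X → ℝ} (hα : 0 < α) (hK : 0 ≤ K)
    (hΞm : AEStronglyMeasurable Ξ μ) (hσm : AEStronglyMeasurable σ μ)
    (hσm' : AEStronglyMeasurable σ' μ)
    (hΞ : ∀ᵐ x ∂μ, α ≤ Ξ x ∧ Ξ x ≤ β) (hσ : ∀ᵐ x ∂μ, |σ x| ≤ β) (hσ' : ∀ᵐ x ∂μ, |σ' x| ≤ β)
    (h₁ : MemLp u₁ 2 μ) (h₂ : MemLp u₂ 2 μ) (h₁' : MemLp u₁' 2 μ) (h₂' : MemLp u₂' 2 μ)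
    (hle : ∫ x, (u₁ x - u₁' x) ^ 2 ∂μ + ∫ x, (u₂ x - u₂' x) ^ 2 ∂μ ≤
      K * ∫ x, (σ x * (u₁ x - 2 / 3 * u₂ x) - σ' x * (u₁' x - 2 / 3 * u₂' x)) ^ 2 ∂μ) :
    eLpNorm (fun x => (σ x - σ' x) * (u₁ x - 2 / 3 * u₂ x)) 2 μ ≤
      ENNReal.ofReal (√(2 + 4 * β ^ 2 * K) / α) *
        eLpNorm (fun x => Ξ x * σ x * (u₁ x - 2 / 3 * u₂ x)
          - Ξ x * σ' x * (u₁' x - 2 / 3 * u₂' x)) 2 μ := by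
  have hψ : MemLp (fun x => u₁ x - 2 / 3 * u₂ x) 2 μ := h₁.sub (h₂.const_mul _)
  have hψ' : MemLp (fun x => u₁' x - 2 / 3 * u₂' x) 2 μ := h₁'.sub (h₂'.const_mul _)
  have hh : MemLp (fun x => σ x * (u₁ x - 2 / 3 * u₂ x) - σ' x * (u₁' x - 2 / 3 * u₂' x)) 2 μ :=
    (memLp_smul_of_bounded hσm hσ hψ).sub (memLp_smul_of_bounded hσm' hσ' hψ')
  have hΞβ : ∀ᵐ x ∂μ, |Ξ x| ≤ β := hΞ.mono fun x hx => by
    rw [abs_of_pos (hα.trans_le hx.1)]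
    exact hx.2
  have hH : MemLp (fun x => Ξ x * σ x * (u₁ x - 2 / 3 * u₂ x)
      - Ξ x * σ' x * (u₁' x - 2 / 3 * u₂' x)) 2 μ := by
    convert memLp_smul_of_bounded hΞm hΞβ hh using 1
    ext x
    simp only [smul_eq_mul]
    ring
  have hL : MemLp (fun x => (σ x - σ' x) * (u₁ x - 2 / 3 * u₂ x)) 2 μ := by
    convert (memLp_smul_of_bounded hσm hσ hψ).sub (memLp_smul_of_bounded hσm' hσ' hψ) using 1
    ext x
    simp only [smul_eq_mul, Pi.sub_apply]
    ring
  have hw₁ : Integrable (fun x => (u₁ x - u₁' x) ^ 2) μ := (h₁.sub h₁').integrable_sq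
  have hw₂ : Integrable (fun x => (u₂ x - u₂' x) ^ 2) μ := (h₂.sub h₂').integrable_sq
  have e₁ : ∫ x, ((σ x - σ' x) * (u₁ x - 2 / 3 * u₂ x)) ^ 2 ∂μ ≤
      2 * ∫ x, (σ x * (u₁ x - 2 / 3 * u₂ x) - σ' x * (u₁' x - 2 / 3 * u₂' x)) ^ 2 ∂μ
      + 4 * β ^ 2 * (∫ x, (u₁ x - u₁' x) ^ 2 ∂μ + ∫ x, (u₂ x - u₂' x) ^ 2 ∂μ) := by
    have hw : Integrable (fun x => 4 * β ^ 2 * ((u₁ x - u₁' x) ^ 2 + (u₂ x - u₂' x) ^ 2)) μ :=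
      (hw₁.add hw₂).const_mul _
    rw [← integral_add hw₁ hw₂, ← integral_const_mul, ← integral_const_mul,
      ← integral_add (hh.integrable_sq.const_mul 2) hw]
    refine integral_mono_ae hL.integrable_sq ((hh.integrable_sq.const_mul 2).add hw) ?_
    filter_upwards [hσ'] with x hx
    have hs : σ' x ^ 2 ≤ β ^ 2 := sq_le_sq.2 (hx.trans (le_abs_self _))
    set h := σ x * (u₁ x - 2 / 3 * u₂ x) - σ' x * (u₁' x - 2 / 3 * u₂' x)
    set a := u₁ x - u₁' x
    set b := u₂ x - u₂' x
    -- The change of coefficient is isolated by moving the change of the fields to the side of the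
    -- known difference `h`.
    have e : (σ x - σ' x) * (u₁ x - 2 / 3 * u₂ x) = h - σ' x * (a - 2 / 3 * b) := by
      simp only [h, a, b]
      ring
    rw [e]
    have i₁ : (h - σ' x * (a - 2 / 3 * b)) ^ 2 ≤ 2 * h ^ 2 + 2 * σ' x ^ 2 * (a - 2 / 3 * b) ^ 2 := by
      nlinarith [sq_nonneg (h + σ' x * (a - 2 / 3 * b))]
    have i₂ : (a - 2 / 3 * b) ^ 2 ≤ 2 * (a ^ 2 + b ^ 2) := by
      nlinarith [sq_nonneg (a + 2 / 3 * b), sq_nonneg b]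
    have i₃ : 2 * σ' x ^ 2 * (a - 2 / 3 * b) ^ 2 ≤ 2 * β ^ 2 * (2 * (a ^ 2 + b ^ 2)) := by gcongr
    linarith
  have e₂ : ∫ x, (σ x * (u₁ x - 2 / 3 * u₂ x) - σ' x * (u₁' x - 2 / 3 * u₂' x)) ^ 2 ∂μ ≤
      1 / α ^ 2 * ∫ x, (Ξ x * σ x * (u₁ x - 2 / 3 * u₂ x)
        - Ξ x * σ' x * (u₁' x - 2 / 3 * u₂' x)) ^ 2 ∂μ := by
    rw [← integral_const_mul]
    refine integral_mono_ae hh.integrable_sq (hH.integrable_sq.const_mul _) ?_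
    filter_upwards [hΞ] with x hx
    rw [one_div, ← div_eq_inv_mul, le_div_iff₀ (by positivity)]
    have hsq : α ^ 2 ≤ Ξ x ^ 2 := by gcongr; exact hx.1
    calc _ ≤ (σ x * (u₁ x - 2 / 3 * u₂ x) - σ' x * (u₁' x - 2 / 3 * u₂' x)) ^ 2 * Ξ x ^ 2 := by
          gcongr
      _ = _ := by ring
  rw [eLpNorm_two_eq hL, eLpNorm_two_eq hH, ← ENNReal.ofReal_mul (by positivity)]
  refine ENNReal.ofReal_le_ofReal ?_
  rw [show √(2 + 4 * β ^ 2 * K) / α = √((2 + 4 * β ^ 2 * K) / α ^ 2) by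
    rw [Real.sqrt_div' _ (by positivity), Real.sqrt_sq hα.le], ← Real.sqrt_mul (by positivity)]
  refine Real.sqrt_le_sqrt ?_
  calc _ ≤ (2 + 4 * β ^ 2 * K) *
        ∫ x, (σ x * (u₁ x - 2 / 3 * u₂ x) - σ' x * (u₁' x - 2 / 3 * u₂' x)) ^ 2 ∂μ := by
        have := mul_le_mul_of_nonneg_left hle (show 0 ≤ 4 * β ^ 2 by positivity)
        linarith
    _ ≤ (2 + 4 * β ^ 2 * K) * (1 / α ^ 2 * ∫ x, (Ξ x * σ x * (u₁ x - 2 / 3 * u₂ x)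
        - Ξ x * σ' x * (u₁' x - 2 / 3 * u₂' x)) ^ 2 ∂μ) := by gcongr
    _ = _ := by ring

end SP2

theorem theorem4p1 (Ω : Set SP2.E3) (hΩ : SP2.IsSmoothDomain Ω)
    (α β : ℝ) (hα : 0 < α) (Ξ σs : SP2.E3 → ℝ)
    (hΞ : ContDiffOn ℝ ∞ Ξ Ω) (hΞb : ∀ x ∈ Ω, α ≤ Ξ x ∧ Ξ x ≤ β)
    (hσs : AEMeasurable σs (SP2.vol Ω)) (hσsb : ∀ x ∈ Ω, α ≤ σs x ∧ σs x ≤ β) :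
    ∃ c : ℝ≥0, ∀ g : ℝ, -1 < g → g < 1 →
      ∀ σa σa' : SP2.E3 → ℝ,
        ContDiffOn ℝ 1 σa (closure Ω) → ContDiffOn ℝ 1 σa' (closure Ω) →
        (∀ x ∈ Ω, α ≤ σa x ∧ σa x ≤ β) → (∀ x ∈ Ω, α ≤ σa' x ∧ σa' x ≤ β) →
      ∀ f : SP2.E3 → ℝ, MemLp f 2 (SP2.surf Ω) →
      ∀ φ₁ φ₂ φ₁' φ₂' : SP2.E3 → ℝ,
        SP2.IsSolution Ω g σa σs f φ₁ φ₂ → SP2.IsSolution Ω g σa' σs f φ₁' φ₂' →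
        (∀ᵐ x ∂(SP2.vol Ω), φ₁ x - 2 / 3 * φ₂ x ≠ 0) →
        (SP2.datum Ξ σa φ₁ φ₂ =ᵐ[SP2.vol Ω] SP2.datum Ξ σa' φ₁' φ₂' →
          σa =ᵐ[SP2.vol Ω] σa') ∧
        eLpNorm (fun x => (σa x - σa' x) * (φ₁ x - 2 / 3 * φ₂ x)) 2 (SP2.vol Ω) ≤
          c * eLpNorm (fun x => SP2.datum Ξ σa φ₁ φ₂ x - SP2.datum Ξ σa' φ₁' φ₂' x) 2
            (SP2.vol Ω) := by
  have ho := hΩ.isOpen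
  obtain ⟨R, hR, hΩR⟩ := hΩ.isBounded.subset_ball_lt 0 0
  -- A simply connected space is nonempty, and the bounds at any one point of `Ω` give `α ≤ β`.
  have hαβ : α ≤ β := by
    have := hΩ.simplyConnected
    obtain ⟨x⟩ := (inferInstance : Nonempty Ω)
    exact (hΞb x x.2).1.trans (hΞb x x.2).2
  have hβ : 0 < β := hα.trans_le hαβ
  -- The largest `m` for which the Friedrichs constants `16R²` and `4R` fit under the energy; it
  -- depends on `R` and `β` only, hence not on `g`.
  set m : ℝ := min (1 / (6 * β) / 7 / (16 * R ^ 2)) (1 / 6 / (4 * R))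
  have hm : 0 < m := lt_min (by positivity) (by positivity)
  have hm₁ : m * (16 * R ^ 2) ≤ 1 / (6 * β) / 7 :=
    (le_div_iff₀ (by positivity)).1 (min_le_left _ _)
  have hm₂ : m * (4 * R) ≤ 1 / 6 := (le_div_iff₀ (by positivity)).1 (min_le_right _ _)
  refine ⟨(√(2 + 4 * β ^ 2 * (2 / m ^ 2)) / α).toNNReal, ?_⟩
  intro g hg₁ hg₂ σa σa' hσa hσa' hσab hσab' f _ φ₁ φ₂ φ₁' φ₂' hs hs' hψ
  have hσam : AEStronglyMeasurable σa (SP2.vol Ω) :=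
    (hσa.continuousOn.mono subset_closure).aestronglyMeasurable ho.measurableSet
  have hσam' : AEStronglyMeasurable σa' (SP2.vol Ω) :=
    (hσa'.continuousOn.mono subset_closure).aestronglyMeasurable ho.measurableSet
  have hest := SP2.solution_sub_estimate hR ho hΩR hα hαβ hg₁ hg₂ hm hm₁ hm₂
    hσs.aestronglyMeasurable hσsb hσam hσab hσam' hσab' hs hs'
  obtain ⟨_, _, _, _, hφ₁, hφ₂, -⟩ := hs
  obtain ⟨_, _, _, _, hφ₁', hφ₂', -⟩ := hs'
  have key := SP2.coefficient_estimate hα (by positivity)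
    (hΞ.continuousOn.aestronglyMeasurable ho.measurableSet) hσam hσam'
    (SP2.ae_vol_of_forall ho hΞb) (SP2.ae_abs_le ho hα hσab) (SP2.ae_abs_le ho hα hσab')
    hφ₁.memLp hφ₂.memLp hφ₁'.memLp hφ₂'.memLp hest
  refine ⟨fun hH => ?_, key⟩
  have hz : eLpNorm (fun x => SP2.datum Ξ σa φ₁ φ₂ x - SP2.datum Ξ σa' φ₁' φ₂' x) 2
      (SP2.vol Ω) = 0 := by
    rw [eLpNorm_congr_ae (g := fun _ => (0 : ℝ)) (hH.mono fun x hx => by simp [hx])]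
    simp
  -- Uniqueness is the estimate with vanishing right-hand side: `(σₐ - σₐ') ψ = 0` almost
  -- everywhere, and `ψ ≠ 0`.
  have hz' : eLpNorm (fun x => (σa x - σa' x) * (φ₁ x - 2 / 3 * φ₂ x)) 2 (SP2.vol Ω) = 0 := by
    exact le_antisymm (key.trans ((congrArg _ hz).trans (mul_zero _)).le) zero_le
  filter_upwards [(eLpNorm_eq_zero_iff ((hσam.sub hσam').mul
    (hφ₁.memLp.1.sub (hφ₂.memLp.1.const_mul _))) (by norm_num)).1 hz', hψ] with x hx hx'
  exact sub_eq_zero.1 ((mul_eq_zero.1 hx).resolve_right hx')
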